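/- **Setting.** Let $E$ be the set of edges of the planar integer lattice $\mathbb Z^2$, and write $h_{x,y}$ for the edge from $(x,y)$ to $(x+1,y)$ and $v_{x,y}$ for the edge from $(x,y)$ to $(x,y+1)$. A *state* is a function $U:E\to\{0,1\}$; an edge is occupied if its value is $1$. A *generator* $\varphi$ consists of a support $\sup(\varphi)\subset E$, a trace $\mathrm{tr}(\varphi)\subset\sup(\varphi)$, and an unordered pair of distinct local states $\hat U_0,\hat U_1:\sup(\varphi)\to\{0,1\}$ that agree off the trace. An *action* of $\varphi$ is a translation $\Phi$ of $\sup(\varphi)$ by a vector of $\mathbb Z^2$. It is *admissible* at $U$ if $U\circ\Phi$ is one of the two local states, and then $\varphi[U]$ is the state that agrees with $U$ off $\Phi(\sup(\varphi))$ and is given by the other local state on $\Phi(\sup(\varphi))$. A collection of actions $(\varphi_i,\Phi_i)_i$ *commutes* if $\Phi_i(\mathrm{tr}(\varphi_i))\cap\Phi_j(\sup(\varphi_j))=\emptyset$ for all $i\ne j$. **The state complex.** Given a collection of states closed under all admissible actions, its state complex $\mathcal S$ is the cubical complex with one $k$-cube for each class $[U;(\Phi_i)_{i=1}^k]$, where $(\Phi_i)$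 is a $k$-tuple of commuting actions, all admissible at the state $U$ of the collection. Two such data give the same cube if and only if their tuples of actions agree up to permutation and their states agree off $\bigcup_i\Phi_i(\sup(\varphi_i))$. The $2k$ faces of the cube are $[U;(\Phi_j)_{j\ne i}]$ and $[\varphi_i[U];(\Phi_j)_{j\ne i}]$, $1\le i\le k$, and $\mathcal S$ is the topological space obtained from the disjoint union of the cubes $[0,1]^k$ by gluing along faces. **The positive articulated arm.** There are two generators. Both have as support the eight edges that meet $(1,0)$ or $(0,1)$. 1. *Corner flip*: the trace is $\{h_{0,0},v_{0,0},v_{1,0},h_{0,1}\}$, and the sets of occupied edges of the two local states are $\{h_{0,0},v_{1,0}\}$ and $\{v_{0,0},h_{0,1}\}$. 2. *End rotation*: the trace is $\{h_{0,0},v_{0,0}\}$, and the sets of occupied edges of the two local states are $\{h_{0,0}\}$ and $\{v_{0,0}\}$. For $N\ge 0$, the positive articulated arm with $N$ segments is the collection of all states that can be reached by admissible actions of these generators from the state whose occupied edges are $v_{0,0},v_{0,1},\dots,v_{0,N-1}$. Let $\mathcal S_N$ be its state complex. **Proposition.** For every $N\ge 0$, the space $\mathcal S_N$ is contractible. -/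

import Mathlib

open scoped unitInterval

namespace Metamorphic

noncomputable section

section General

/-- A generator on a set `L` of lattice sites: a support, a trace contained in it, and two distinct
local states on the support (`localState false` and `localState true`) that agree off the trace.
The pair of local states is used symmetrically below, i.e. as an unordered pair. -/
structure Generator (L : Type*) where
  support : Set L
  trace : Set L
  trace_subset : trace ⊆ support
  localState : Bool → support → Bool
  eq_off_trace : ∀ x : support, (x : L) ∉ trace → localState false x = localState true x
  nondegenerate : localState false ≠ localState true

/-- A state of the workspace; here the workspace consists of all sites of the lattice `L`. -/
abbrev State (L : Type*) := L → Bool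

variable {T L ι : Type*} [AddGroup T] [AddAction T L]

/-- A catalogue is a family `C : ι → Generator L`. An action of the generator `C i` is the translate
of its support by an element `t` of the group `T` of lattice translations; it is recorded as the
pair `(i, t)`. -/
abbrev Action (T ι : Type*) := ι × T

/-- The translated support `Φ(sup φ)` of an action. -/
def Action.sup (C : ι → Generator L) (a : Action T ι) : Set L :=
  {x | -a.2 +ᵥ x ∈ (C a.1).support}

/-- The translated trace `Φ(tr φ)` of an action. -/
def Action.tr (C : ι → Generator L) (a : Action T ι) : Set L :=
  {x | -a.2 +ᵥ x ∈ (C a.1).trace}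

/-- The state `U`, seen through the action `a`, is the local state number `b`. -/
def Action.Matches (C : ι → Generator L) (a : Action T ι) (b : Bool) (U : State L) : Prop :=
  ∀ x : (C a.1).support, U (a.2 +ᵥ (x : L)) = (C a.1).localState b x

/-- The action `a` is admissible at `U` if `U` matches one of the two local states. -/
def Action.Admissible (C : ι → Generator L) (a : Action T ι) (U : State L) : Prop :=
  ∃ b, a.Matches C b U

open scoped Classical in
/-- Overwrite `U` on the translated support of `a` by the local state number `b`. If `U` matches the
local state number `!b`, this is the state `φ[U]`. If `U` matches number `b`, it is `U`. -/
def Action.place (C : ι → Generator L) (a : Action T ι) (b : Bool) (U : State L) : State L :=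
  fun x => if h : x ∈ a.sup C then (C a.1).localState b ⟨-a.2 +ᵥ x, h⟩ else U x

/-- A set of actions commutes if the trace of each is disjoint from the support of each other one.
(A commuting tuple never repeats an action, as traces are nonempty, so that commuting tuples up to
permutation are the same as finite commuting sets.) -/
def Commute (C : ι → Generator L) (S : Set (Action T ι)) : Prop :=
  ∀ a ∈ S, ∀ b ∈ S, a ≠ b → Disjoint (a.tr C) (b.sup C)

/-- A local metamorphic system with catalogue `C` and translation group `T`: a collection of finite
states closed under all admissible actions. -/
structure LocalSystem (T : Type*) {L ι : Type*} [AddGroup T] [AddAction T L]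
    (C : ι → Generator L) where
  states : Set (State L)
  finite : ∀ U ∈ states, {x | U x = true}.Finite
  closed : ∀ U ∈ states, ∀ (a : Action T ι) (b : Bool), a.Matches C b U → a.place C (!b) U ∈ states

/-- The states reachable from `U₀` by admissible actions. -/
inductive Reachable (T : Type*) {L ι : Type*} [AddGroup T] [AddAction T L]
    (C : ι → Generator L) (U₀ : State L) : State L → Prop
  | start : Reachable T C U₀ U₀
  | move (U : State L) (a : Action T ι) (b : Bool) :
      Reachable T C U₀ U → a.Matches C b U → Reachable T C U₀ (a.place C (!b) U)

/-- The local metamorphic system generated by a finite state, for a catalogue of generators with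
finite supports. -/
def LocalSystem.generate (T : Type*) {L ι : Type*} [AddGroup T] [AddAction T L]
    (C : ι → Generator L) (hC : ∀ i, (C i).support.Finite)
    (U₀ : State L) (h₀ : {x | U₀ x = true}.Finite) : LocalSystem T C where
  states := {U | Reachable T C U₀ U}
  finite := by
    intro U hU
    induction hU with
    | start => exact h₀
    | move U a b _ _ ih =>
      refine (ih.union ((hC a.1).image fun y => a.2 +ᵥ y)).subset ?_
      intro x hx
      by_cases h : x ∈ a.sup C
      · exact Or.inr ⟨_, h, by simp⟩
      · left
        simpa [Action.place, h] using hx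
  closed := fun U hU a b hm => Reachable.move U a b hU hm

lemma Action.Matches.place_eq {C : ι → Generator L} {a : Action T ι} {b : Bool} {U : State L}
    (h : a.Matches C b U) : a.place C b U = U := by
  funext x
  by_cases hx : x ∈ a.sup C
  · have := h ⟨_, hx⟩
    simp only [vadd_neg_vadd] at this
    simp [Action.place, hx, this]
  · simp [Action.place, hx]

lemma Generator.localState_eq (φ : Generator L) (b c : Bool) (x : φ.support)
    (hx : (x : L) ∉ φ.trace) : φ.localState b x = φ.localState c x := by
  have := φ.eq_off_trace x hx
  cases b <;> cases c <;> simp [this]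

lemma Action.place_eq_off_trace {C : ι → Generator L} {a : Action T ι} {U : State L}
    (h : a.Admissible C U) (c : Bool) {x : L} (hx : x ∉ a.tr C) : a.place C c U x = U x := by
  obtain ⟨b, hb⟩ := h
  conv_rhs => rw [← hb.place_eq]
  by_cases hs : x ∈ a.sup C
  · simp only [Action.place, hs, dite_true]
    exact (C a.1).localState_eq _ _ _ hx
  · simp [Action.place, hs]

variable {C : ι → Generator L}

lemma LocalSystem.place_mem (M : LocalSystem T C) {U : State L} (hU : U ∈ M.states)
    {a : Action T ι} (h : a.Admissible C U) (c : Bool) : a.place C c U ∈ M.states := by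
  obtain ⟨b, hb⟩ := h
  by_cases hcb : c = b
  · subst hcb
    rwa [hb.place_eq]
  · have : c = !b := by cases b <;> cases c <;> simp_all
    subst this
    exact M.closed U hU a b hb

/-- A representative `(U; (Φ_i))` of a cube of the state complex: a state of the system and a finite
commuting set of actions, all admissible at that state. The dimension of the cube is the number of
actions. -/
@[ext]
structure Cube (M : LocalSystem T C) where
  state : State L
  mem : state ∈ M.states
  acts : Set (Action T ι)
  finite : acts.Finite
  commute : Commute C acts
  admissible : ∀ a ∈ acts, a.Admissible C state

/-- Two representatives give the same cube: they have the same actions, and their states agree off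
the union of the supports of these actions. -/
def Cube.Same {M : LocalSystem T C} (c d : Cube M) : Prop :=
  c.acts = d.acts ∧ ∀ x, (∀ a ∈ c.acts, x ∉ a.sup C) → c.state x = d.state x

/-- The two faces of a cube in the direction of one of its actions `a`: delete `a`, and put its
support into the local state number `b`. One of the two resulting states is `U` and the other one
is `φ[U]`. -/
def Cube.face {M : LocalSystem T C} (c : Cube M) (a : Action T ι) (ha : a ∈ c.acts) (b : Bool) :
    Cube M where
  state := a.place C b c.state
  mem := M.place_mem c.mem (c.admissible a ha) b
  acts := c.acts \ {a}
  finite := c.finite.subset Set.sdiff_subset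
  commute := fun x hx y hy hxy => c.commute x hx.1 y hy.1 hxy
  admissible := by
    rintro d ⟨hd, hda⟩
    obtain ⟨e, he⟩ := c.admissible d hd
    refine ⟨e, fun x => ?_⟩
    have hdis := c.commute a ha d hd (fun h => hda (by simp [h]))
    have hx : d.2 +ᵥ (x : L) ∈ d.sup C := by simp [Action.sup]
    rw [Action.place_eq_off_trace (c.admissible a ha) b (Set.disjoint_right.1 hdis hx)]
    exact he x

/-- The end of the unit interval at which an action has local state number `b`. -/
def endpoint (b : Bool) : I := if b then 1 else 0

/-- The disjoint union, over all representatives, of the cubes `[0,1]^k`. The coordinate belonging to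
an action is `0` where that action is in its local state number `false` and `1` where it is in its
local state number `true`, so that it does not depend on the choice of the representative. -/
abbrev CubePoint (M : LocalSystem T C) := Σ c : Cube M, (c.acts → I)

/-- The identifications that build the state complex from its cubes: different representatives of
the same cube are identified, and each face of a cube is glued to the cube that it is. -/
inductive Glue (M : LocalSystem T C) : CubePoint M → CubePoint M → Prop
  | same (c d : Cube M) (h : c.Same d) (p : c.acts → I) (q : d.acts → I)
      (hpq : ∀ a (hc : a ∈ c.acts) (hd : a ∈ d.acts), p ⟨a, hc⟩ = q ⟨a, hd⟩) :
      Glue M ⟨c, p⟩ ⟨d, q⟩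
  | face (c : Cube M) (a : Action T ι) (ha : a ∈ c.acts) (b : Bool) (p : c.acts → I)
      (hp : p ⟨a, ha⟩ = endpoint b) :
      Glue M ⟨c, p⟩ ⟨c.face a ha b, fun x => p ⟨x.1, x.2.1⟩⟩

/-- The state complex of a local metamorphic system, as a topological space: the quotient (with the
quotient topology) of the disjoint union of the cubes by the equivalence relation generated by the
identifications `Glue`. -/
def StateComplex (M : LocalSystem T C) : Type _ := Quot (Glue M)

instance (M : LocalSystem T C) : TopologicalSpace (StateComplex M) :=
  inferInstanceAs (TopologicalSpace (Quot (Glue M)))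

end General

section Arm

/-- Horizontal or vertical. -/
inductive Dir
  | right
  | up

/-- An edge of the planar integer lattice: the unit segment from `base` to `base + (1,0)` if `dir` is
`right`, and from `base` to `base + (0,1)` if `dir` is `up`. -/
@[ext]
structure LatticeEdge where
  base : ℤ × ℤ
  dir : Dir

/-- Integer vectors act on the edges by translation. -/
instance : AddAction (ℤ × ℤ) LatticeEdge where
  vadd t e := ⟨t + e.base, e.dir⟩
  zero_vadd e := LatticeEdge.ext (zero_add e.base) rfl
  add_vadd s t e := LatticeEdge.ext (add_assoc s t e.base) rfl

/-- The horizontal edge from `(x,y)` to `(x+1,y)`. -/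
def hEdge (x y : ℤ) : LatticeEdge := ⟨(x, y), Dir.right⟩

/-- The vertical edge from `(x,y)` to `(x,y+1)`. -/
def vEdge (x y : ℤ) : LatticeEdge := ⟨(x, y), Dir.up⟩

/-- The eight edges that meet `(1,0)` or `(0,1)`: the four edges of the unit square, then the other
two edges at `(1,0)` and the other two edges at `(0,1)`. -/
def cornerEdges : Set LatticeEdge :=
  {hEdge 0 0, vEdge 0 0, vEdge 1 0, hEdge 0 1,
    hEdge 1 0, vEdge 1 (-1), vEdge 0 1, hEdge (-1) 1}

lemma cornerEdges_finite : cornerEdges.Finite := by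
  unfold cornerEdges
  exact Set.toFinite _

open scoped Classical in
/-- Flipping a corner: the path right-up from `(0,0)` to `(1,1)` is exchanged with the path up-right.
The trace consists of the four edges of the square; the other edges at the two corners `(1,0)` and
`(0,1)` are unoccupied. -/
def cornerFlip : Generator LatticeEdge where
  support := cornerEdges
  trace := {hEdge 0 0, vEdge 0 0, vEdge 1 0, hEdge 0 1}
  trace_subset := by
    intro e he
    simp only [Set.mem_insert_iff, Set.mem_singleton_iff] at he
    simp only [cornerEdges, Set.mem_insert_iff, Set.mem_singleton_iff]
    tauto
  localState b e :=
    if b then decide (e.1 = vEdge 0 0 ∨ e.1 = hEdge 0 1)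
    else decide (e.1 = hEdge 0 0 ∨ e.1 = vEdge 1 0)
  eq_off_trace := by
    intro e he
    simp only [Set.mem_insert_iff, Set.mem_singleton_iff, not_or] at he
    simp [he]
  nondegenerate := by
    intro h
    have := congrFun h ⟨hEdge 0 0, by simp [cornerEdges]⟩
    simp [hEdge, vEdge] at this

open scoped Classical in
/-- Rotating the end of the arm: the edge from `(0,0)` to `(1,0)` is exchanged with the edge from
`(0,0)` to `(0,1)`. The trace consists of these two edges; the other edges at `(1,0)` and `(0,1)` are
unoccupied, so that the moving edge is the last one of the arm. -/
def endRotation : Generator LatticeEdge where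
  support := cornerEdges
  trace := {hEdge 0 0, vEdge 0 0}
  trace_subset := by
    intro e he
    simp only [Set.mem_insert_iff, Set.mem_singleton_iff] at he
    simp only [cornerEdges, Set.mem_insert_iff, Set.mem_singleton_iff]
    tauto
  localState b e := if b then decide (e.1 = vEdge 0 0) else decide (e.1 = hEdge 0 0)
  eq_off_trace := by
    intro e he
    simp only [Set.mem_insert_iff, Set.mem_singleton_iff, not_or] at he
    simp [he]
  nondegenerate := by
    intro h
    have := congrFun h ⟨hEdge 0 0, by simp [cornerEdges]⟩
    simp [hEdge, vEdge] at this

/-- The names of the two generators of the arm. -/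
inductive ArmMove
  | flip
  | rotate

/-- The catalogue of the positive articulated arm. -/
def armCatalogue : ArmMove → Generator LatticeEdge
  | ArmMove.flip => cornerFlip
  | ArmMove.rotate => endRotation

open scoped Classical in
/-- The state with `N` vertical edges end-to-end, starting at the origin. -/
def verticalArm (N : ℕ) : State LatticeEdge :=
  fun e => decide (∃ i : ℕ, i < N ∧ e = vEdge 0 i)

lemma verticalArm_finite (N : ℕ) : {e | verticalArm N e = true}.Finite := by
  refine ((Set.finite_Iio N).image fun i : ℕ => vEdge 0 i).subset ?_
  intro e he
  obtain ⟨i, hi, rfl⟩ : ∃ i : ℕ, i < N ∧ e = vEdge 0 i := by simpa [verticalArm] using he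
  exact ⟨i, hi, rfl⟩

lemma armCatalogue_finite (m : ArmMove) : (armCatalogue m).support.Finite := by
  cases m <;> exact cornerEdges_finite

/-- The positive articulated robot arm with `N` segments: the local metamorphic system on the edges
of the planar integer lattice generated from the vertical arm by corner flips and end rotations. -/
def positiveArm (N : ℕ) : LocalSystem (ℤ × ℤ) armCatalogue :=
  LocalSystem.generate (ℤ × ℤ) armCatalogue armCatalogue_finite (verticalArm N)
    (verticalArm_finite N)

end Arm

end

end Metamorphic

/-!
An arm with `N` segments is a monotone lattice path from the origin, and it is determined by the
heights `y 1, …, y N` of its vertices, where consecutive heights differ by `0` or `1` and `y 0 = 0`.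
A move changes the height of one vertex by `1`: a corner flip moves an inner vertex, an end rotation
moves the last one. Two different moves that are admissible at the same arm commute exactly when the
vertices they move are not adjacent.

Letting the heights be real therefore identifies the state complex with the space `HeightSpace N`
of all `y` such that consecutive heights satisfy `a ≤ b ≤ a + 1` and at least one of them is an
integer: the vertices at non-integral height are those in the course of a move. The map
`heightMap N` to this space is continuous and bijective (`injective_heightMap`, `surjective_heightMap`). The
complex has finitely many cubes, so it is compact, and the map is a homeomorphism
(`heightHomeomorph`).

The condition on consecutive heights is closed under minima (`Link.min`), and it holds for the
values of the function `staircase N` at `s` and `s + 1` (`link_staircase`). Hence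
`y ↦ min (y k) (staircase N (t + k))` maps `HeightSpace N` to itself for each `t`. It is the identity for large
`t` and zero for small `t`, so that `HeightSpace N` is contractible.
-/

namespace Metamorphic

/-! ### The space of height functions and its contraction -/

/-- The relation between consecutive real heights `a`, `b`: the step lies in `[0,1]`, and at least
one of the two vertices sits at an integral height, i.e. is not in the course of a move. -/
def Link (a b : ℝ) : Prop :=
  a ≤ b ∧ b ≤ a + 1 ∧ ((∃ m : ℤ, a = m) ∨ ∃ m : ℤ, b = m)

lemma Link.one_add {a b : ℝ} (h : Link a b) : Link (1 + a) (1 + b) := by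
  obtain ⟨h1, h2, h3⟩ := h
  refine ⟨by linarith, by linarith, h3.imp ?_ ?_⟩ <;>
  · rintro ⟨m, rfl⟩
    exact ⟨1 + m, by push_cast; ring⟩

lemma Link.eq_of_lt {a b a' b' : ℝ} (h : Link a b) (h' : Link a' b') (ha : a < a') (hb : b' < b) :
    (∃ m : ℤ, a = m) ∨ ∃ m : ℤ, b' = m := by
  obtain ⟨h1, h2, h3⟩ := h
  obtain ⟨h1', h2', h3'⟩ := h'
  rcases h3 with h3 | ⟨m, rfl⟩
  · exact Or.inl h3
  rcases h3' with ⟨n, rfl⟩ | h3'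
  · -- the integer `n` would lie strictly between `m - 1` and `m`
    have h4 : (m : ℝ) < n + 1 := by linarith
    have h5 : (n : ℝ) < m := by linarith
    norm_cast at h4 h5
    omega
  · exact Or.inr h3'

/-- Linked pairs are closed under minima: if both minima were non-integral and attained by different
pairs, then an integer would lie strictly between two consecutive ones. -/
lemma Link.min {a b a' b' : ℝ} (h : Link a b) (h' : Link a' b') :
    Link (min a a') (min b b') := by
  refine ⟨min_le_min h.1 h'.1, ?_, ?_⟩
  · rw [← min_add_add_right]
    exact min_le_min h.2.1 h'.2.1
  · rcases le_or_gt a a' with ha | ha <;> rcases le_or_gt b b' with hb | hb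
    · simpa [ha, hb] using h.2.2
    · rcases ha.eq_or_lt with rfl | ha
      · simpa [hb.le] using h'.2.2
      · simpa [ha.le, hb.le] using h.eq_of_lt h' ha hb
    · rcases hb.eq_or_lt with rfl | hb
      · simpa [ha.le] using h'.2.2
      · simpa [ha.le, hb.le] using h'.eq_of_lt h ha hb
    · simpa [ha.le, hb.le] using h'.2.2

/-- The space of height functions: `y k` is the height of the vertex number `k` of an arm whose
vertex number `0` is the origin, and where vertices in the course of a move have non-integral
height. Outside of `0 ≤ k ≤ N` the value is set to `0`. -/
def HeightSpace (N : ℕ) : Set (ℤ → ℝ) :=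
  {y | (∀ k : ℤ, k ≤ 0 ∨ (N : ℤ) < k → y k = 0) ∧
    ∀ k : ℤ, 0 ≤ k → k < N → Link (y k) (y (k + 1))}

lemma HeightSpace.mem_Icc {N : ℕ} {y : ℤ → ℝ} (hy : y ∈ HeightSpace N) (k : ℕ) (hk : k ≤ N) :
    0 ≤ y k ∧ y k ≤ k := by
  induction k with
  | zero => simp [hy.1 0 (Or.inl le_rfl)]
  | succ k ih =>
    have h1 := ih (by omega)
    have h2 := hy.2 k (by omega) (by omega)
    push_cast
    exact ⟨h1.1.trans h2.1, by linarith [h2.2.1]⟩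

/-- A continuous staircase with `n` steps of height `1`, rising on the intervals `[2j, 2j+1]` with
`0 ≤ j < n` and constant elsewhere. -/
noncomputable def staircase : ℕ → ℝ → ℝ
  | 0, _ => 0
  | n + 1, s => max 0 (min 1 s) + staircase n (s - 2)

lemma continuous_staircase (n : ℕ) : Continuous (staircase n) := by
  induction n with
  | zero => exact continuous_const
  | succ n ih =>
    have : Continuous fun s : ℝ => staircase n (s - 2) := ih.comp (by fun_prop)
    change Continuous fun s : ℝ => max 0 (min 1 s) + staircase n (s - 2)
    fun_prop

lemma staircase_nonneg (n : ℕ) (s : ℝ) : 0 ≤ staircase n s := by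
  induction n generalizing s with
  | zero => exact le_rfl
  | succ n ih => exact add_nonneg (le_max_left _ _) (ih _)

lemma staircase_of_nonpos (n : ℕ) {s : ℝ} (hs : s ≤ 0) : staircase n s = 0 := by
  induction n generalizing s with
  | zero => rfl
  | succ n ih =>
    rw [staircase, ih (by linarith), max_eq_left ((min_le_right _ _).trans hs), add_zero]

lemma staircase_of_ge (n : ℕ) {s : ℝ} (hs : 2 * n ≤ s) : staircase n s = n := by
  induction n generalizing s with
  | zero => simp [staircase]
  | succ n ih =>
    push_cast at hs ⊢
    have hn : (0 : ℝ) ≤ n := n.cast_nonneg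
    rw [staircase, ih (by linarith), min_eq_left (by linarith), max_eq_right zero_le_one, add_comm]

lemma link_staircase (n : ℕ) (s : ℝ) : Link (staircase n s) (staircase n (s + 1)) := by
  induction n generalizing s with
  | zero => exact ⟨le_rfl, by simp [staircase], Or.inl ⟨0, by simp [staircase]⟩⟩
  | succ n ih =>
    rcases le_or_gt s 1 with hs | hs
    · rw [staircase, staircase, staircase_of_nonpos n (by linarith : s - 2 ≤ 0),
        staircase_of_nonpos n (by linarith : s + 1 - 2 ≤ 0), add_zero, add_zero, min_eq_right hs]
      rcases le_total s 0 with h0 | h0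
      · rw [max_eq_left h0]
        exact ⟨le_max_left _ _, by simp, Or.inl ⟨0, by simp⟩⟩
      · rw [max_eq_right h0, min_eq_left (by linarith), max_eq_right zero_le_one]
        exact ⟨hs, by linarith, Or.inr ⟨1, by simp⟩⟩
    · have h := (ih (s - 2)).one_add
      rw [staircase, staircase, min_eq_left hs.le, min_eq_left (by linarith),
        max_eq_right zero_le_one]
      convert h using 3
      ring

lemma zero_mem_heightSpace (N : ℕ) : (0 : ℤ → ℝ) ∈ HeightSpace N :=
  ⟨fun _ _ => rfl, fun _ _ _ => ⟨le_rfl, by simp, Or.inl ⟨0, by simp⟩⟩⟩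

lemma min_staircase_mem {N : ℕ} {y : ℤ → ℝ} (hy : y ∈ HeightSpace N) (t : ℝ) :
    (fun k : ℤ => min (y k) (staircase N (t + k))) ∈ HeightSpace N := by
  refine ⟨fun k hk => ?_, fun k h0 hN => ?_⟩
  · simp only [hy.1 k hk, min_eq_left (staircase_nonneg _ _)]
  · have h := (hy.2 k h0 hN).min (link_staircase N (t + k))
    rw [add_assoc] at h
    simpa using h

/-- Cutting a height function off at the travelling staircase `k ↦ staircase N (t + k)` does nothing
for `t = 2N` and gives the constant `0` for `t = -N`. -/
theorem contractibleSpace_heightSpace (N : ℕ) : ContractibleSpace (HeightSpace N) := by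
  rw [contractible_iff_id_nullhomotopic]
  refine ⟨⟨0, zero_mem_heightSpace N⟩, ⟨{
    toFun := fun p => ⟨_, min_staircase_mem p.2.2 (2 * N - 3 * N * (p.1 : ℝ))⟩
    continuous_toFun := ?_
    map_zero_left := ?_
    map_one_left := ?_ }⟩⟩
  · refine Continuous.subtype_mk (continuous_pi fun k => ?_) _
    have h1 : Continuous fun p : I × HeightSpace N => (p.2 : ℤ → ℝ) k :=
      (continuous_apply k).comp (continuous_subtype_val.comp continuous_snd)
    have h2 : Continuous fun p : I × HeightSpace N =>
        staircase N (2 * N - 3 * N * (p.1 : ℝ) + k) :=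
      (continuous_staircase N).comp (by fun_prop)
    exact h1.min h2
  · rintro ⟨y, hy⟩
    refine Subtype.ext (funext fun k => ?_)
    simp only [Set.Icc.coe_zero, mul_zero, sub_zero, ContinuousMap.id_apply]
    by_cases hk : k ≤ 0 ∨ (N : ℤ) < k
    · rw [hy.1 k hk, min_eq_left (staircase_nonneg _ _)]
    · push Not at hk
      lift k to ℕ using hk.1.le
      have hkN : k ≤ N := by omega
      have hkN' : (k : ℝ) ≤ N := by exact_mod_cast hkN
      have hk0 : (0 : ℝ) ≤ k := k.cast_nonneg
      rw [staircase_of_ge N (by push_cast; linarith)]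
      exact min_eq_left ((HeightSpace.mem_Icc hy k hkN).2.trans hkN')
  · rintro ⟨y, hy⟩
    refine Subtype.ext (funext fun k => ?_)
    simp only [Set.Icc.coe_one, mul_one, ContinuousMap.const_apply, Pi.zero_apply]
    by_cases hk : k ≤ 0 ∨ (N : ℤ) < k
    · rw [hy.1 k hk, min_eq_left (staircase_nonneg _ _)]
    · push Not at hk
      lift k to ℕ using hk.1.le
      have hkN : k ≤ N := by omega
      have hkN' : (k : ℝ) ≤ N := by exact_mod_cast hkN
      rw [staircase_of_nonpos N (by push_cast; linarith)]
      exact min_eq_right (HeightSpace.mem_Icc hy k hkN).1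

/-! ### Arms given by height functions -/

/-- The rise of an edge in the given direction. -/
def Dir.rise : Dir → ℤ
  | Dir.right => 0
  | Dir.up => 1

/-- The level of an edge: along an arm, the edge number `i` has level `i`. -/
def LatticeEdge.level (e : LatticeEdge) : ℤ := e.base.1 + e.base.2

/-- Integral height functions of arms with `N` segments. -/
def IsHeight (N : ℕ) (y : ℤ → ℤ) : Prop :=
  (∀ k : ℤ, k ≤ 0 ∨ (N : ℤ) < k → y k = 0) ∧
    ∀ k : ℤ, 0 ≤ k → k < N → y (k + 1) = y k ∨ y (k + 1) = y k + 1

open scoped Classical in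
/-- The arm whose vertex number `k` is `(k - y k, y k)`, for `0 ≤ k ≤ N`. -/
noncomputable def pathState (N : ℕ) (y : ℤ → ℤ) : State LatticeEdge := fun e =>
  decide (0 ≤ e.level ∧ e.level < N ∧ y e.level = e.base.2 ∧
    y (e.level + 1) = e.base.2 + e.dir.rise)

lemma pathState_eq_true {N : ℕ} {y : ℤ → ℤ} {e : LatticeEdge} {i : ℤ} (hi : e.level = i) :
    pathState N y e = true ↔
      0 ≤ i ∧ i < N ∧ y i = e.base.2 ∧ y (i + 1) = e.base.2 + e.dir.rise := by
  subst hi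
  simp [pathState]

/-- A bit as an integer. -/
def bitInt (b : Bool) : ℤ := if b then 1 else 0

/-! ### Admissible actions of an arm -/

/-- The number of the vertex of the arm that is moved by an action. -/
def Action.vertex (a : Action (ℤ × ℤ) ArmMove) : ℤ := a.2.1 + a.2.2 + 1

/-- In terms of the height function `y`: the action `a` sees the local state number `b`. The vertex
before the moved one is at the base point of `a`, the moved vertex is at height `b` above it, and
either the move is a corner flip and the vertex after it is at height `1` above the base point, or
the move is an end rotation and there is no vertex after it. -/
structure Fits (N : ℕ) (y : ℤ → ℤ) (a : Action (ℤ × ℤ) ArmMove) (b : Bool) : Prop where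
  pos : 1 ≤ a.vertex
  le : a.vertex ≤ N
  before : y (a.vertex - 1) = a.2.2
  at_vertex : y a.vertex = a.2.2 + bitInt b
  after : a.1 = ArmMove.flip → a.vertex < N ∧ y (a.vertex + 1) = a.2.2 + 1
  last : a.1 = ArmMove.rotate → a.vertex = N

lemma mem_sup_iff {a : Action (ℤ × ℤ) ArmMove} {e : LatticeEdge} :
    e ∈ a.sup armCatalogue ↔
      (e.level = a.vertex - 1 ∧ (e.base.2 = a.2.2 ∨ e.base.2 = a.2.2 + 1 - 2 * e.dir.rise)) ∨
      (e.level = a.vertex ∧ (e.base.2 = a.2.2 ∨ e.base.2 = a.2.2 + 1)) := by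
  obtain ⟨m, t1, t2⟩ := a
  obtain ⟨⟨x, z⟩, d⟩ := e
  have key : (⟨⟨x, z⟩, d⟩ : LatticeEdge) ∈ Action.sup armCatalogue (m, t1, t2) ↔
      (⟨(-t1 + x, -t2 + z), d⟩ : LatticeEdge) ∈ cornerEdges := by
    cases m <;> rfl
  rw [key]
  simp only [cornerEdges, hEdge, vEdge, Set.mem_insert_iff, Set.mem_singleton_iff,
    LatticeEdge.mk.injEq, Prod.mk.injEq, LatticeEdge.level, Action.vertex]
  cases d <;> simp [Dir.rise] <;> omega

lemma mem_tr_flip_iff {t : ℤ × ℤ} {e : LatticeEdge} :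
    e ∈ Action.tr armCatalogue (ArmMove.flip, t) ↔
      (e.level = t.1 + t.2 ∧ e.base.2 = t.2) ∨
      (e.level = t.1 + t.2 + 1 ∧ e.base.2 = t.2 + 1 - e.dir.rise) := by
  obtain ⟨t1, t2⟩ := t
  obtain ⟨⟨x, z⟩, d⟩ := e
  have key : (⟨⟨x, z⟩, d⟩ : LatticeEdge) ∈ Action.tr armCatalogue (ArmMove.flip, t1, t2) ↔
      (⟨(-t1 + x, -t2 + z), d⟩ : LatticeEdge) ∈ cornerFlip.trace := Iff.rfl
  rw [key]
  simp only [cornerFlip, hEdge, vEdge, Set.mem_insert_iff, Set.mem_singleton_iff,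
    LatticeEdge.mk.injEq, Prod.mk.injEq, LatticeEdge.level]
  cases d <;> simp [Dir.rise] <;> omega

/-- The edges at which the local state number `b` of an action is occupied. -/
lemma localState_eq_true {m : ArmMove} {b : Bool} (e : (armCatalogue m).support) :
    (armCatalogue m).localState b e = true ↔
      (e.1.level = 0 ∧ e.1.base.2 = 0 ∧ e.1.dir.rise = bitInt b) ∨
      (m = ArmMove.flip ∧ e.1.level = 1 ∧ e.1.base.2 = bitInt b ∧ e.1.dir.rise = 1 - bitInt b) := by
  obtain ⟨⟨⟨x, z⟩, d⟩, he⟩ := e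
  cases m <;> cases b <;> cases d <;>
    simp [armCatalogue, cornerFlip, endRotation, hEdge, vEdge, LatticeEdge.level, Dir.rise,
      bitInt] <;> omega

/-- An action sees a local state if and only if it does so on each edge of its support. -/
lemma matches_iff {m : ArmMove} {t : ℤ × ℤ} {b : Bool} {U : State LatticeEdge} :
    Action.Matches armCatalogue (m, t) b U ↔
      ∀ e ∈ Action.sup armCatalogue (m, t), (U e = true ↔
        (e.level = t.1 + t.2 ∧ e.base.2 = t.2 ∧ e.dir.rise = bitInt b) ∨
        (m = ArmMove.flip ∧ e.level = t.1 + t.2 + 1 ∧ e.base.2 = t.2 + bitInt b ∧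
          e.dir.rise = 1 - bitInt b)) := by
  have key (x : LatticeEdge) (hx : x ∈ (armCatalogue m).support) :
      (U (t +ᵥ x) = (armCatalogue m).localState b ⟨x, hx⟩) ↔ (U (t +ᵥ x) = true ↔
        ((t +ᵥ x).level = t.1 + t.2 ∧ (t +ᵥ x).base.2 = t.2 ∧ (t +ᵥ x).dir.rise = bitInt b) ∨
        (m = ArmMove.flip ∧ (t +ᵥ x).level = t.1 + t.2 + 1 ∧ (t +ᵥ x).base.2 = t.2 + bitInt b ∧
          (t +ᵥ x).dir.rise = 1 - bitInt b)) := by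
    rw [Bool.eq_iff_iff, localState_eq_true]
    have h1 : (t +ᵥ x).level = t.1 + t.2 + x.level := by
      change t.1 + x.base.1 + (t.2 + x.base.2) = _
      unfold LatticeEdge.level
      ring
    have h2 : (t +ᵥ x).base.2 = t.2 + x.base.2 := rfl
    have h3 : (t +ᵥ x).dir = x.dir := rfl
    rw [h1, h2, h3]
    simp [add_assoc]
  constructor
  · intro h e he
    have := (key _ he).1 (h ⟨_, he⟩)
    simpa only [vadd_neg_vadd] using this
  · intro h x
    have hx : t +ᵥ (x : LatticeEdge) ∈ Action.sup armCatalogue (m, t) := by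
      simp [Action.sup]
    exact (key _ x.2).2 (h _ hx)

lemma matches_pathState_iff {N : ℕ} {y : ℤ → ℤ} (hy : IsHeight N y)
    {a : Action (ℤ × ℤ) ArmMove} {b : Bool} :
    a.Matches armCatalogue b (pathState N y) ↔ Fits N y a b := by
  obtain ⟨m, t1, t2⟩ := a
  rw [matches_iff]
  simp only [mem_sup_iff]
  constructor
  · intro h
    -- the edge from the base point to the moved vertex
    have h1 := h ⟨(t1, t2), if b then Dir.up else Dir.right⟩
      (Or.inl ⟨by simp [LatticeEdge.level, Action.vertex], Or.inl rfl⟩)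
    rw [pathState_eq_true (i := t1 + t2) rfl] at h1
    have h1 := h1.2 (Or.inl ⟨rfl, rfl, by cases b <;> rfl⟩)
    have hr : (if b then Dir.up else Dir.right).rise = bitInt b := by cases b <;> rfl
    simp only [hr] at h1
    obtain ⟨h1, h2, h3, h4⟩ := h1
    refine ⟨by simp [Action.vertex]; omega, by simp [Action.vertex]; omega,
      by simpa [Action.vertex] using h3, by simpa [Action.vertex] using h4, ?_, ?_⟩
    · rintro ⟨⟩
      have h5 := h ⟨(t1 + 1 - bitInt b, t2 + bitInt b), if b then Dir.right else Dir.up⟩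
        (Or.inr ⟨by simp [LatticeEdge.level, Action.vertex]; ring, by cases b <;> simp [bitInt]⟩)
      have hr : (if b then Dir.right else Dir.up).rise = 1 - bitInt b := by cases b <;> rfl
      rw [pathState_eq_true (i := t1 + t2 + 1) (by simp [LatticeEdge.level]; ring)] at h5
      have h5 := h5.2 (Or.inr ⟨rfl, by simp [LatticeEdge.level]; ring, rfl, hr⟩)
      simp only [hr] at h5
      exact ⟨h5.2.1, by simpa [Action.vertex] using h5.2.2.2⟩
    · rintro ⟨⟩
      by_contra hN
      have hN' : t1 + t2 + 1 < N := lt_of_le_of_ne (by omega) hN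
      -- otherwise one of the two edges after the moved vertex is occupied
      have key (d : Dir) : y (t1 + t2 + 1 + 1) ≠ t2 + bitInt b + d.rise := by
        intro h6
        have h5 := h ⟨(t1 + 1 - bitInt b, t2 + bitInt b), d⟩
          (Or.inr ⟨by simp [LatticeEdge.level, Action.vertex]; ring, by cases b <;> simp [bitInt]⟩)
        rw [pathState_eq_true (i := t1 + t2 + 1) (by simp [LatticeEdge.level]; ring)] at h5
        rcases h5.1 ⟨by omega, hN', h4, h6⟩ with h7 | h7
        · have := h7.1
          simp [LatticeEdge.level] at this
        · exact absurd h7.1 (by simp)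
      rcases hy.2 (t1 + t2 + 1) (by omega) hN' with h6 | h6
      · exact key Dir.right (by simp [Dir.rise]; omega)
      · exact key Dir.up (by simp [Dir.rise]; omega)
  · rintro ⟨h1, h2, h3, h4, h5, h6⟩ ⟨⟨x, z⟩, d⟩ he
    simp only [Action.vertex] at *
    have hb : bitInt b = 0 ∨ bitInt b = 1 := by cases b <;> simp [bitInt]
    have hd : d.rise = 0 ∨ d.rise = 1 := by cases d <;> simp [Dir.rise]
    have h3' : y (t1 + t2) = t2 := by rwa [add_sub_cancel_right] at h3
    rcases he with ⟨he, hz⟩ | ⟨he, hz⟩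
    · rw [pathState_eq_true (i := t1 + t2) (by rw [he]; ring)]
      simp only [he] at *
      rw [h3', h4]
      constructor
      · rintro ⟨-, -, rfl, h⟩
        exact Or.inl ⟨by ring, rfl, by omega⟩
      · rintro (⟨-, rfl, h⟩ | ⟨-, h, -⟩)
        · exact ⟨by omega, by omega, rfl, by omega⟩
        · omega
    · rw [pathState_eq_true he, h4]
      simp only [he]
      cases m
      · obtain ⟨h5, h5'⟩ := h5 rfl
        rw [h5']
        constructor
        · rintro ⟨-, -, h7, h8⟩
          exact Or.inr ⟨rfl, trivial, h7.symm, by omega⟩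
        · rintro (⟨h7, -⟩ | ⟨-, -, h7, h8⟩)
          · omega
          · exact ⟨by omega, h5, h7.symm, by omega⟩
      · have h6 := h6 rfl
        constructor
        · rintro ⟨-, h7, -⟩
          omega
        · rintro (⟨h7, -⟩ | ⟨h7, -⟩)
          · omega
          · cases h7

lemma bitInt_eq (b : Bool) : bitInt b = 0 ∨ bitInt b = 1 := by cases b <;> simp [bitInt]

lemma Dir.rise_eq (d : Dir) : d.rise = 0 ∨ d.rise = 1 := by cases d <;> simp [Dir.rise]

/-- The height function that an action leaves behind when it is put into its local state `b`. -/
def moveHeight (y : ℤ → ℤ) (a : Action (ℤ × ℤ) ArmMove) (b : Bool) : ℤ → ℤ :=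
  Function.update y a.vertex (a.2.2 + bitInt b)

lemma moveHeight_of_ne {y : ℤ → ℤ} {a : Action (ℤ × ℤ) ArmMove} {b : Bool} {k : ℤ}
    (hk : k ≠ a.vertex) : moveHeight y a b k = y k :=
  Function.update_of_ne hk _ _

lemma moveHeight_vertex {y : ℤ → ℤ} {a : Action (ℤ × ℤ) ArmMove} {b : Bool} :
    moveHeight y a b a.vertex = a.2.2 + bitInt b :=
  Function.update_self _ _ _

lemma Fits.flip_iff {N : ℕ} {y : ℤ → ℤ} {a : Action (ℤ × ℤ) ArmMove} {b : Bool}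
    (h : Fits N y a b) : a.1 = ArmMove.flip ↔ a.vertex < N := by
  constructor
  · exact fun h' => (h.after h').1
  · intro h'
    cases ha : a.1
    · rfl
    · exact absurd (h.last ha) h'.ne

lemma Fits.after_of_lt {N : ℕ} {y : ℤ → ℤ} {a : Action (ℤ × ℤ) ArmMove} {b : Bool}
    (h : Fits N y a b) (hN : a.vertex < N) : y (a.vertex + 1) = a.2.2 + 1 :=
  (h.after (h.flip_iff.2 hN)).2

lemma Fits.moveHeight {N : ℕ} {y : ℤ → ℤ} {a : Action (ℤ × ℤ) ArmMove} {b : Bool}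
    (h : Fits N y a b) (c : Bool) : Fits N (moveHeight y a c) a c where
  pos := h.pos
  le := h.le
  before := by rw [moveHeight_of_ne (by omega), h.before]
  at_vertex := moveHeight_vertex
  after := fun h' => by
    rw [moveHeight_of_ne (by omega)]
    exact h.after h'
  last := h.last

lemma Fits.isHeight {N : ℕ} {y : ℤ → ℤ} {a : Action (ℤ × ℤ) ArmMove} {b : Bool}
    (h : Fits N y a b) (hy : IsHeight N y) (c : Bool) :
    IsHeight N (Metamorphic.moveHeight y a c) := by
  have hc := bitInt_eq c
  refine ⟨fun k hk => ?_, fun k h0 hN => ?_⟩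
  · rw [moveHeight_of_ne (by have := h.pos; have := h.le; omega), hy.1 k hk]
  · rcases eq_or_ne k a.vertex with rfl | hk
    · rw [moveHeight_vertex, moveHeight_of_ne (by omega), h.after_of_lt hN]
      omega
    · rw [moveHeight_of_ne hk]
      rcases eq_or_ne (k + 1) a.vertex with hk' | hk'
      · have := h.before
        rw [← hk', add_sub_cancel_right] at this
        rw [hk', moveHeight_vertex, this]
        omega
      · rw [moveHeight_of_ne hk']
        exact hy.2 k h0 hN

lemma place_eq_of_matches {T L ι : Type*} [AddGroup T] [AddAction T L] {C : ι → Generator L}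
    {a : Action T ι} {b : Bool} {U V : State L} (hV : a.Matches C b V)
    (h : ∀ x ∉ a.sup C, U x = V x) : a.place C b U = V := by
  rw [← hV.place_eq]
  funext x
  by_cases hx : x ∈ a.sup C
  · simp [Action.place, hx]
  · simp [Action.place, hx, h x hx]

lemma Fits.place_pathState {N : ℕ} {y : ℤ → ℤ} {a : Action (ℤ × ℤ) ArmMove} {b : Bool}
    (h : Fits N y a b) (hy : IsHeight N y) (c : Bool) :
    a.place armCatalogue c (pathState N y) = pathState N (Metamorphic.moveHeight y a c) := by
  refine place_eq_of_matches ((matches_pathState_iff (h.isHeight hy c)).2 (h.moveHeight c)) ?_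
  intro e he
  rw [mem_sup_iff, not_or] at he
  have hb := bitInt_eq b
  have hc := bitInt_eq c
  have hd := e.dir.rise_eq
  rw [Bool.eq_iff_iff, pathState_eq_true rfl, pathState_eq_true rfl]
  by_cases h1 : e.level = a.vertex
  · rw [h1, moveHeight_vertex, moveHeight_of_ne (by omega), h.at_vertex]
    have := fun h' => h.after_of_lt h'
    omega
  · by_cases h2 : e.level + 1 = a.vertex
    · rw [moveHeight_of_ne h1, h2, moveHeight_vertex, h.at_vertex]
      have h3 := h.before
      rw [← h2, add_sub_cancel_right] at h3
      rw [h3]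
      omega
    · rw [moveHeight_of_ne h1, moveHeight_of_ne h2]

lemma IsHeight.ext_pathState {N : ℕ} {y z : ℤ → ℤ} (hy : IsHeight N y) (hz : IsHeight N z)
    (h : pathState N y = pathState N z) : y = z := by
  have key (k : ℕ) (hk : k ≤ N) : y k = z k := by
    induction k with
    | zero => simp [hy.1 0, hz.1 0]
    | succ k ih =>
      have ih := ih (by omega)
      have h0 := hy.2 k (by omega) (by omega)
      obtain ⟨d, hd⟩ : ∃ d : Dir, y (k + 1) = y k + d.rise :=
        h0.elim (fun h => ⟨Dir.right, by simp [h, Dir.rise]⟩)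
          fun h => ⟨Dir.up, by simp [h, Dir.rise]⟩
      have h1 : pathState N y ⟨(k - y k, y k), d⟩ = true :=
        (pathState_eq_true (i := k) (by simp [LatticeEdge.level])).2
          ⟨by omega, by omega, rfl, hd⟩
      rw [h, pathState_eq_true (i := k) (by simp [LatticeEdge.level])] at h1
      push_cast
      exact hd.trans h1.2.2.2.symm
  funext k
  by_cases hk : k ≤ 0 ∨ (N : ℤ) < k
  · rw [hy.1 k hk, hz.1 k hk]
  · push Not at hk
    lift k to ℕ using hk.1.le
    exact key k (by omega)

lemma IsHeight.mem_Icc {N : ℕ} {y : ℤ → ℤ} (hy : IsHeight N y) (k : ℕ) (hk : k ≤ N) :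
    0 ≤ y k ∧ y k ≤ k := by
  induction k with
  | zero => simp [hy.1 0]
  | succ k ih =>
    have h1 := ih (by omega)
    have h2 := hy.2 k (by omega) (by omega)
    push_cast
    omega

/-! ### Reachable states -/

/-- The heights of the vertical arm. -/
def verticalHeight (N : ℕ) (k : ℤ) : ℤ := if 0 ≤ k ∧ k ≤ N then k else 0

lemma isHeight_verticalHeight (N : ℕ) : IsHeight N (verticalHeight N) := by
  refine ⟨fun k hk => ?_, fun k h0 hN => Or.inr ?_⟩ <;> simp only [verticalHeight] <;>
    split_ifs <;> omega

lemma verticalArm_eq (N : ℕ) : verticalArm N = pathState N (verticalHeight N) := by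
  funext e
  rw [Bool.eq_iff_iff, pathState_eq_true rfl]
  obtain ⟨⟨x, z⟩, d⟩ := e
  have key : verticalArm N ⟨(x, z), d⟩ = true ↔
      ∃ i : ℕ, i < N ∧ (⟨(x, z), d⟩ : LatticeEdge) = vEdge 0 i := by
    simp only [verticalArm, decide_eq_true_eq]
  have hlev : (⟨(x, z), d⟩ : LatticeEdge).level = x + z := rfl
  rw [key, hlev]
  simp only [vEdge, LatticeEdge.mk.injEq, Prod.mk.injEq, verticalHeight]
  constructor
  · rintro ⟨i, hi, ⟨rfl, rfl⟩, rfl⟩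
    simp only [Dir.rise]
    refine ⟨by omega, by omega, ?_, ?_⟩ <;> split_ifs <;> omega
  · rintro ⟨h1, h2, h3, h4⟩
    rw [if_pos ⟨by omega, by omega⟩] at h3 h4
    refine ⟨z.toNat, by omega, ⟨by omega, by omega⟩, ?_⟩
    cases d
    · simp only [Dir.rise] at h4
      omega
    · rfl

/-- The action that moves vertex number `k` of the arm with heights `y`, when there is one. -/
def actionAt (N : ℕ) (y : ℤ → ℤ) (k : ℤ) : Action (ℤ × ℤ) ArmMove :=
  (if k < N then ArmMove.flip else ArmMove.rotate, k - 1 - y (k - 1), y (k - 1))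

@[simp] lemma actionAt_vertex (N : ℕ) (y : ℤ → ℤ) (k : ℤ) : (actionAt N y k).vertex = k := by
  simp [actionAt, Action.vertex]

lemma fits_actionAt {N : ℕ} {y : ℤ → ℤ} {k : ℤ} {b : Bool} (h1 : 1 ≤ k) (hN : k ≤ N)
    (hk : y k = y (k - 1) + bitInt b) (hk' : k < N → y (k + 1) = y (k - 1) + 1) :
    Fits N y (actionAt N y k) b where
  pos := by simpa
  le := by simpa
  before := by simp; rfl
  at_vertex := by rw [actionAt_vertex]; exact hk
  after := fun h => by
    have : k < N := by
      by_contra h'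
      simp [actionAt, h'] at h
    rw [actionAt_vertex]
    exact ⟨this, hk' this⟩
  last := fun h => by
    have : ¬ k < N := by
      intro h'
      simp [actionAt, h'] at h
    simp
    omega

lemma Fits.eq_actionAt {N : ℕ} {y : ℤ → ℤ} {a : Action (ℤ × ℤ) ArmMove} {b : Bool}
    (h : Fits N y a b) : a = actionAt N y a.vertex := by
  obtain ⟨m, t1, t2⟩ := a
  have h1 := h.before
  have h2 := h.flip_iff
  simp only [actionAt, h1]
  refine Prod.ext ?_ (Prod.ext ?_ rfl)
  · cases m
    · simp [h2.1 rfl]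
    · simpa using h2
  · simp [Action.vertex]

/-- Every arm can be straightened out into the vertical arm: look at the last horizontal edge, and
move its end up. -/
lemma reachable_pathState {N : ℕ} {y : ℤ → ℤ} (hy : IsHeight N y) :
    Reachable (ℤ × ℤ) armCatalogue (verticalArm N) (pathState N y) := by
  -- the induction is on the number of squares between the arm and the vertical arm
  obtain ⟨n, hn⟩ : ∃ n : ℕ, ∑ k ∈ Finset.range (N + 1), ((k : ℤ) - y k) = n := by
    refine Int.eq_ofNat_of_zero_le (Finset.sum_nonneg fun k hk => ?_)
    have := hy.mem_Icc k (by simpa [Nat.lt_succ_iff] using hk)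
    omega
  induction n using Nat.strong_induction_on generalizing y with
  | _ n ih =>
    by_cases hv : ∃ k : ℕ, k < N ∧ y (k + 1) = y k
    · classical
      obtain ⟨k, ⟨hkN, hk⟩, hmax⟩ : ∃ k : ℕ, (k < N ∧ y (k + 1) = y k) ∧
          ∀ l : ℕ, k < l → l < N → y (l + 1) = y l + 1 := by
        obtain ⟨k0, hk0⟩ := hv
        refine ⟨Nat.findGreatest (fun k => k < N ∧ y (k + 1) = y k) N,
          Nat.findGreatest_spec (P := fun k => k < N ∧ y (k + 1) = y k) hk0.1.le hk0, ?_⟩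
        intro l hl hlN
        have h1 := Nat.findGreatest_is_greatest hl hlN.le
        have h2 := hy.2 l (by omega) (by omega)
        tauto
      have hfit : Fits N y (actionAt N y (k + 1)) false := by
        refine fits_actionAt (by omega) (by omega) (by simp [bitInt, hk]) fun h => ?_
        have := hmax (k + 1) (by omega) (by omega)
        push_cast at this
        rw [this, hk, add_sub_cancel_right]
      set a := actionAt N y (k + 1) with ha
      have hav : a.vertex = ((k + 1 : ℕ) : ℤ) := by simp [ha]
      set z := moveHeight y a true with hz
      have hzv : z ((k + 1 : ℕ) : ℤ) = y ((k + 1 : ℕ) : ℤ) + 1 := by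
        rw [← hav, hz, moveHeight_vertex, hfit.at_vertex]
        simp [bitInt]
      have hzo (l : ℕ) (hl : l ≠ k + 1) : z l = y l :=
        moveHeight_of_ne (by rw [hav]; exact_mod_cast hl)
      have hsum : ∑ k ∈ Finset.range (N + 1), ((k : ℤ) - z k) = n - 1 := by
        have hmem : k + 1 ∈ Finset.range (N + 1) := by simp; omega
        rw [← hn, ← Finset.add_sum_erase _ _ hmem, ← Finset.add_sum_erase _ _ hmem, hzv,
          Finset.sum_congr rfl fun l hl => by rw [hzo l (Finset.ne_of_mem_erase hl)]]
        ring
      have hzh : IsHeight N z := hfit.isHeight hy true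
      have hn0 : 0 ≤ ∑ k ∈ Finset.range (N + 1), ((k : ℤ) - z k) := by
        refine Finset.sum_nonneg fun k hk => ?_
        have := hzh.mem_Icc k (by simpa [Nat.lt_succ_iff] using hk)
        omega
      have hz' := hfit.moveHeight true
      have hstep := Reachable.move _ a true (ih (n - 1) (by omega) hzh (by omega))
        ((matches_pathState_iff hzh).2 hz')
      rw [hz'.place_pathState hzh] at hstep
      convert hstep using 2
      funext l
      rcases eq_or_ne l a.vertex with rfl | hl
      · rw [Bool.not_true, moveHeight_vertex, hfit.at_vertex]
      · rw [moveHeight_of_ne hl, moveHeight_of_ne hl]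
    · push Not at hv
      have hyv : y = verticalHeight N := by
        have key (k : ℕ) (hk : k ≤ N) : y k = k := by
          induction k with
          | zero => simp [hy.1 0]
          | succ k ih' =>
            have h1 := ih' (by omega)
            have h2 := hv k (by omega)
            have h3 := hy.2 k (by omega) (by omega)
            push_cast
            omega
        funext k
        by_cases hk : k ≤ 0 ∨ (N : ℤ) < k
        · rw [hy.1 k hk, (isHeight_verticalHeight N).1 k hk]
        · push Not at hk
          lift k to ℕ using hk.1.le
          rw [key k (by omega), verticalHeight, if_pos (by omega)]
      rw [hyv, ← verticalArm_eq]
      exact Reachable.start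

/-- The states of the positive articulated arm are the monotone lattice paths of length `N` from the
origin. -/
lemma mem_states_positiveArm {N : ℕ} {U : State LatticeEdge} :
    U ∈ (positiveArm N).states ↔ ∃ y, IsHeight N y ∧ U = pathState N y := by
  constructor
  · intro hU
    change Reachable (ℤ × ℤ) armCatalogue (verticalArm N) U at hU
    induction hU with
    | start => exact ⟨_, isHeight_verticalHeight N, verticalArm_eq N⟩
    | move U a b _ hm ih =>
      obtain ⟨y, hy, rfl⟩ := ih
      have h := (matches_pathState_iff hy).1 hm
      exact ⟨_, h.isHeight hy _, h.place_pathState hy _⟩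
  · rintro ⟨y, hy, rfl⟩
    exact reachable_pathState hy

/-! ### Commuting actions -/

/-- Commuting actions that are admissible at the same arm do not move adjacent vertices. -/
lemma Fits.vertex_ne_add_one {N : ℕ} {y : ℤ → ℤ} {a a' : Action (ℤ × ℤ) ArmMove} {b b' : Bool}
    (h : Fits N y a b) (h' : Fits N y a' b')
    (hd : Disjoint (a.tr armCatalogue) (a'.sup armCatalogue)) : a'.vertex ≠ a.vertex + 1 := by
  intro hv
  have hflip : a.1 = ArmMove.flip := h.flip_iff.2 (by have := h'.le; omega)
  have h1 := h'.before
  rw [hv, add_sub_cancel_right, h.at_vertex] at h1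
  obtain ⟨d, hrise⟩ : ∃ d : Dir, d.rise = 1 - bitInt b := by
    cases b
    · exact ⟨Dir.up, by simp [Dir.rise, bitInt]⟩
    · exact ⟨Dir.right, by simp [Dir.rise, bitInt]⟩
  -- the edge of the arm after the vertex moved by `a` is in the trace of `a`
  have hlev : (⟨(a.vertex - a'.2.2, a'.2.2), d⟩ : LatticeEdge).level = a.vertex := by
    simp [LatticeEdge.level]
  refine Set.disjoint_left.1 hd (?_ : (⟨(a.vertex - a'.2.2, a'.2.2), d⟩ : LatticeEdge) ∈ _) ?_
  · obtain ⟨m, t⟩ := a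
    subst hflip
    rw [mem_tr_flip_iff, hlev, hrise]
    exact Or.inr ⟨rfl, by simp only at h1 ⊢; omega⟩
  · rw [mem_sup_iff, hlev]
    exact Or.inl ⟨by omega, Or.inl rfl⟩

lemma Action.tr_subset_sup {T L ι : Type*} [AddGroup T] [AddAction T L] (C : ι → Generator L)
    (a : Action T ι) : a.tr C ⊆ a.sup C :=
  fun _ hx => (C a.1).trace_subset hx

lemma level_of_mem_sup {a : Action (ℤ × ℤ) ArmMove} {e : LatticeEdge}
    (he : e ∈ a.sup armCatalogue) : e.level = a.vertex - 1 ∨ e.level = a.vertex :=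
  (mem_sup_iff.1 he).imp And.left And.left

lemma disjoint_of_vertex {a a' : Action (ℤ × ℤ) ArmMove} (h : a.vertex ≠ a'.vertex)
    (h1 : a'.vertex ≠ a.vertex + 1) (h2 : a.vertex ≠ a'.vertex + 1) :
    Disjoint (a.tr armCatalogue) (a'.sup armCatalogue) := by
  refine Set.disjoint_left.2 fun e he he' => ?_
  have h3 := level_of_mem_sup (a.tr_subset_sup _ he)
  have h4 := level_of_mem_sup he'
  omega

/-! ### The height function of a point of the state complex -/

/-- Every point of a state complex lies in the interior of some cube. -/
lemma exists_interior_representative {T L ι : Type*} [AddGroup T] [AddAction T L]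
    {C : ι → Generator L} {M : LocalSystem T C} (c : Cube M) (p : c.acts → I) :
    ∃ (d : Cube M) (q : d.acts → I), Quot.mk (Glue M) ⟨c, p⟩ = Quot.mk (Glue M) ⟨d, q⟩ ∧
      ∀ (a : d.acts) (b : Bool), q a ≠ endpoint b := by
  obtain ⟨n, hn⟩ : ∃ n, c.acts.ncard = n := ⟨_, rfl⟩
  induction n using Nat.strong_induction_on generalizing c with
  | _ n ih =>
    by_cases h : ∃ (a : c.acts) (b : Bool), p a = endpoint b
    · obtain ⟨⟨a, ha⟩, b, hb⟩ := h
      obtain ⟨d, q, h1, h2⟩ := ih _ (by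
        rw [← hn]
        exact Set.ncard_sdiff_singleton_lt_of_mem ha c.finite) (c.face a ha b)
        (fun x => p ⟨x.1, x.2.1⟩) rfl
      exact ⟨d, q, (Quot.sound (Glue.face c a ha b p hb)).trans h1, h2⟩
    · push Not at h
      exact ⟨c, p, rfl, h⟩

variable {N : ℕ}

/-- The heights of the state of a cube. -/
noncomputable def Cube.height (c : Cube (positiveArm N)) : ℤ → ℤ :=
  (mem_states_positiveArm.1 c.mem).choose

lemma Cube.isHeight (c : Cube (positiveArm N)) : IsHeight N c.height :=
  (mem_states_positiveArm.1 c.mem).choose_spec.1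

lemma Cube.state_eq (c : Cube (positiveArm N)) : c.state = pathState N c.height :=
  (mem_states_positiveArm.1 c.mem).choose_spec.2

lemma Cube.height_eq {c : Cube (positiveArm N)} {y : ℤ → ℤ} (hy : IsHeight N y)
    (h : c.state = pathState N y) : c.height = y :=
  c.isHeight.ext_pathState hy (c.state_eq.symm.trans h)

lemma Cube.exists_fits (c : Cube (positiveArm N)) {a : Action (ℤ × ℤ) ArmMove} (ha : a ∈ c.acts) :
    ∃ b, Fits N c.height a b := by
  obtain ⟨b, hb⟩ := c.admissible a ha
  rw [c.state_eq, matches_pathState_iff c.isHeight] at hb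
  exact ⟨b, hb⟩

lemma Cube.vertex_injOn (c : Cube (positiveArm N)) {a a' : Action (ℤ × ℤ) ArmMove}
    (ha : a ∈ c.acts) (ha' : a' ∈ c.acts) (h : a.vertex = a'.vertex) : a = a' := by
  obtain ⟨b, hb⟩ := c.exists_fits ha
  obtain ⟨b', hb'⟩ := c.exists_fits ha'
  rw [hb.eq_actionAt, hb'.eq_actionAt, h]

lemma Cube.vertex_ne_add_one (c : Cube (positiveArm N)) {a a' : Action (ℤ × ℤ) ArmMove}
    (ha : a ∈ c.acts) (ha' : a' ∈ c.acts) : a'.vertex ≠ a.vertex + 1 := by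
  obtain ⟨b, hb⟩ := c.exists_fits ha
  obtain ⟨b', hb'⟩ := c.exists_fits ha'
  rcases eq_or_ne a a' with rfl | hne
  · omega
  · exact hb.vertex_ne_add_one hb' (c.commute a ha a' ha' hne)

/-- The vertices that are moved by the actions of a cube. -/
def Cube.moved (c : Cube (positiveArm N)) : Set ℤ := Action.vertex '' c.acts

open scoped Classical in
/-- The real height function of a point of a cube: a vertex that is moved by an action is above the
base point of that action by the coordinate belonging to the action, and all other vertices have the
height that they have in the state of the cube. -/
noncomputable def Cube.coord (c : Cube (positiveArm N)) (p : c.acts → I) (k : ℤ) : ℝ :=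
  if h : ∃ a : c.acts, a.1.vertex = k then (h.choose.1.2.2 : ℝ) + (p h.choose : ℝ)
  else (c.height k : ℝ)

lemma Cube.coord_vertex (c : Cube (positiveArm N)) (p : c.acts → I)
    {a : Action (ℤ × ℤ) ArmMove} (ha : a ∈ c.acts) :
    c.coord p a.vertex = (a.2.2 : ℝ) + (p ⟨a, ha⟩ : ℝ) := by
  have h : ∃ a' : c.acts, a'.1.vertex = a.vertex := ⟨⟨a, ha⟩, rfl⟩
  have h' : h.choose = ⟨a, ha⟩ :=
    Subtype.ext (c.vertex_injOn h.choose.2 ha h.choose_spec)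
  rw [Cube.coord, dif_pos h, h']

lemma Cube.coord_of_notMem (c : Cube (positiveArm N)) (p : c.acts → I) {k : ℤ}
    (hk : k ∉ c.moved) : c.coord p k = (c.height k : ℝ) := by
  rw [Cube.coord, dif_neg]
  rintro ⟨a, ha⟩
  exact hk ⟨a.1, a.2, ha⟩

lemma Cube.continuous_coord (c : Cube (positiveArm N)) : Continuous c.coord := by
  refine continuous_pi fun k => ?_
  unfold Cube.coord
  split_ifs with h
  · exact continuous_const.add (continuous_subtype_val.comp (continuous_apply h.choose))
  · exact continuous_const

lemma Cube.coord_mem (c : Cube (positiveArm N)) (p : c.acts → I) : c.coord p ∈ HeightSpace N := by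
  refine ⟨fun k hk => ?_, fun k h0 hN => ?_⟩
  · rw [c.coord_of_notMem, c.isHeight.1 k hk, Int.cast_zero]
    rintro ⟨a, ha, rfl⟩
    obtain ⟨b, hb⟩ := c.exists_fits ha
    have := hb.pos
    have := hb.le
    omega
  · by_cases hk : k ∈ c.moved
    · obtain ⟨a, ha, rfl⟩ := hk
      obtain ⟨b, hb⟩ := c.exists_fits ha
      rw [c.coord_vertex p ha, c.coord_of_notMem, hb.after_of_lt hN]
      · have h1 := (p ⟨a, ha⟩).2.1
        have h2 := (p ⟨a, ha⟩).2.2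
        push_cast
        exact ⟨by linarith, by linarith, Or.inr ⟨a.2.2 + 1, by push_cast; rfl⟩⟩
      · rintro ⟨a', ha', h⟩
        exact c.vertex_ne_add_one ha ha' h
    rw [c.coord_of_notMem p hk]
    by_cases hk' : k + 1 ∈ c.moved
    · obtain ⟨a, ha, hak⟩ := hk'
      obtain ⟨b, hb⟩ := c.exists_fits ha
      have h := hb.before
      rw [hak, add_sub_cancel_right] at h
      rw [← hak, c.coord_vertex p ha, h]
      have h1 := (p ⟨a, ha⟩).2.1
      have h2 := (p ⟨a, ha⟩).2.2
      exact ⟨by linarith, by linarith, Or.inl ⟨_, rfl⟩⟩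
    · rw [c.coord_of_notMem p hk']
      have h := c.isHeight.2 k h0 hN
      refine ⟨?_, ?_, Or.inl ⟨_, rfl⟩⟩ <;> norm_cast <;> omega

/-- Arms that admit the same actions and agree off the supports of these actions have the same
unmoved vertices. -/
lemma Cube.Same.height_eq {c d : Cube (positiveArm N)} (h : c.Same d) {k : ℤ} (hk : k ∉ c.moved) :
    c.height k = d.height k := by
  have key (n : ℕ) : (n : ℤ) ≤ N → (n : ℤ) ∉ c.moved → c.height n = d.height n := by
    induction n with
    | zero => simp [c.isHeight.1 0, d.isHeight.1 0]
    | succ n ih =>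
      intro hN hn
      push_cast at hN hn ⊢
      by_cases hn' : (n : ℤ) ∈ c.moved
      · obtain ⟨a, ha, han⟩ := hn'
        obtain ⟨b, hb⟩ := c.exists_fits ha
        obtain ⟨b', hb'⟩ := d.exists_fits (h.1 ▸ ha)
        rw [← han, hb.after_of_lt (by omega), hb'.after_of_lt (by omega)]
      · have ih := ih (by omega) hn'
        -- the edge after the vertex number `n` is off the supports
        obtain ⟨r, hr⟩ : ∃ r : Dir, c.height (n + 1) = c.height n + r.rise :=
          (c.isHeight.2 n (by omega) (by omega)).elim
            (fun h => ⟨Dir.right, by simp [h, Dir.rise]⟩) fun h => ⟨Dir.up, by simp [h, Dir.rise]⟩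
        have hlev : (⟨(n - c.height n, c.height n), r⟩ : LatticeEdge).level = n := by
          simp [LatticeEdge.level]
        have h1 : c.state ⟨(n - c.height n, c.height n), r⟩ = true := by
          rw [c.state_eq, pathState_eq_true hlev]
          exact ⟨by omega, by omega, rfl, hr⟩
        rw [h.2, d.state_eq, pathState_eq_true hlev] at h1
        · exact hr.trans h1.2.2.2.symm
        · intro a ha hsup
          have h2 := level_of_mem_sup hsup
          rw [hlev] at h2
          exact h2.elim (fun h2 => hn ⟨a, ha, by omega⟩) fun h2 => hn' ⟨a, ha, h2.symm⟩
  by_cases hk' : k ≤ 0 ∨ (N : ℤ) < k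
  · rw [c.isHeight.1 k hk', d.isHeight.1 k hk']
  · push Not at hk'
    lift k to ℕ using hk'.1.le
    exact key k hk'.2 hk

lemma Cube.height_face (c : Cube (positiveArm N)) {a : Action (ℤ × ℤ) ArmMove} (ha : a ∈ c.acts)
    (b : Bool) : (c.face a ha b).height = moveHeight c.height a b := by
  obtain ⟨e, he⟩ := c.exists_fits ha
  refine Cube.height_eq (he.isHeight c.isHeight b) ?_
  rw [← he.place_pathState c.isHeight, ← c.state_eq]
  rfl

lemma coord_eq_of_glue {x y : CubePoint (positiveArm N)} (h : Glue (positiveArm N) x y) :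
    x.1.coord x.2 = y.1.coord y.2 := by
  cases h with
  | same c d h p q hpq =>
    funext k
    by_cases hk : k ∈ c.moved
    · obtain ⟨a, ha, rfl⟩ := hk
      have ha' : a ∈ d.acts := h.1 ▸ ha
      rw [c.coord_vertex p ha, d.coord_vertex q ha', hpq a ha ha']
    · have hk' : k ∉ d.moved := by rwa [Cube.moved, ← h.1]
      rw [c.coord_of_notMem p hk, d.coord_of_notMem q hk', h.height_eq hk]
  | face c a ha b p hp =>
    funext k
    by_cases hk : k ∈ (c.face a ha b).moved
    · obtain ⟨a', ha', rfl⟩ := hk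
      rw [(c.face a ha b).coord_vertex _ ha', c.coord_vertex p ha'.1]
    · rw [(c.face a ha b).coord_of_notMem _ hk, c.height_face]
      rcases eq_or_ne k a.vertex with rfl | hka
      · rw [c.coord_vertex p ha, hp, moveHeight_vertex]
        cases b <;> simp [endpoint, bitInt]
      · rw [c.coord_of_notMem p, moveHeight_of_ne hka]
        rintro ⟨a', ha', rfl⟩
        exact hk ⟨a', ⟨ha', fun h => hka (congrArg _ h)⟩, rfl⟩

/-- The height function of a point of the state complex of the arm. -/
noncomputable def heightMap (N : ℕ) : StateComplex (positiveArm N) → HeightSpace N :=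
  Quot.lift (fun x => ⟨x.1.coord x.2, x.1.coord_mem x.2⟩)
    fun _ _ h => Subtype.ext (coord_eq_of_glue h)

lemma continuous_heightMap (N : ℕ) : Continuous (heightMap N) :=
  continuous_quot_lift _ (continuous_sigma fun c => c.continuous_coord.subtype_mk _)

/-! ### Injectivity -/

/-- At an interior point of a cube, the moved vertices are those at non-integral heights. -/
lemma Cube.mem_moved_iff (c : Cube (positiveArm N)) {p : c.acts → I}
    (hp : ∀ (a : c.acts) (b : Bool), p a ≠ endpoint b) (k : ℤ) :
    k ∈ c.moved ↔ ∀ m : ℤ, c.coord p k ≠ m := by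
  constructor
  · rintro ⟨a, ha, rfl⟩ m hm
    rw [c.coord_vertex p ha] at hm
    have h0 : (0 : ℝ) < p ⟨a, ha⟩ :=
      lt_of_le_of_ne (p ⟨a, ha⟩).2.1 fun h => hp ⟨a, ha⟩ false (Subtype.ext h.symm)
    have h1 : (p ⟨a, ha⟩ : ℝ) < 1 :=
      lt_of_le_of_ne (p ⟨a, ha⟩).2.2 fun h => hp ⟨a, ha⟩ true (Subtype.ext h)
    have h2 : (a.2.2 : ℝ) < m := by linarith
    have h3 : (m : ℝ) < a.2.2 + 1 := by linarith
    norm_cast at h2 h3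
    omega
  · intro h
    by_contra hk
    exact h _ (c.coord_of_notMem p hk)

lemma Cube.acts_eq_of_coord_eq {c d : Cube (positiveArm N)} {p : c.acts → I} {q : d.acts → I}
    (hp : ∀ (a : c.acts) (b : Bool), p a ≠ endpoint b)
    (hq : ∀ (a : d.acts) (b : Bool), q a ≠ endpoint b) (h : c.coord p = d.coord q) :
    c.acts ⊆ d.acts := by
  have hmoved : c.moved = d.moved := by
    ext k
    rw [c.mem_moved_iff hp, d.mem_moved_iff hq, h]
  intro a ha
  obtain ⟨b, hb⟩ := c.exists_fits ha
  have hm : a.vertex ∈ d.moved := hmoved ▸ ⟨a, ha, rfl⟩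
  obtain ⟨a', ha', hv⟩ := hm
  obtain ⟨b', hb'⟩ := d.exists_fits ha'
  -- the vertex before the moved one is unmoved in both cubes
  have hc : a.vertex - 1 ∉ c.moved := by
    rintro ⟨e, he, hev⟩
    exact c.vertex_ne_add_one he ha (by omega)
  have h1 := congrFun h (a.vertex - 1)
  rw [c.coord_of_notMem p hc, d.coord_of_notMem q (hmoved ▸ hc)] at h1
  have h2 : c.height (a.vertex - 1) = d.height (a.vertex - 1) := by exact_mod_cast h1
  have : a = a' := by
    rw [hb.eq_actionAt, hb'.eq_actionAt, hv]
    simp only [actionAt, h2]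
  rwa [this]

lemma injective_heightMap (N : ℕ) : Function.Injective (heightMap N) := by
  rintro ⟨c, p⟩ ⟨d, q⟩ h
  obtain ⟨c', p', hc, hp⟩ := exists_interior_representative c p
  obtain ⟨d', q', hd, hq⟩ := exists_interior_representative d q
  change Quot.mk _ _ = Quot.mk _ _
  change heightMap N (Quot.mk _ _) = heightMap N (Quot.mk _ _) at h
  rw [hc, hd] at h ⊢
  clear hc hd
  replace h : c'.coord p' = d'.coord q' := congrArg Subtype.val h
  have hacts : c'.acts = d'.acts :=
    (Cube.acts_eq_of_coord_eq hp hq h).antisymm (Cube.acts_eq_of_coord_eq hq hp h.symm)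
  have hheight (k : ℤ) (hk : k ∉ c'.moved) : c'.height k = d'.height k := by
    have h1 := congrFun h k
    have hk' : k ∉ d'.moved := by rwa [Cube.moved, ← hacts]
    rw [c'.coord_of_notMem p' hk, d'.coord_of_notMem q' hk'] at h1
    exact_mod_cast h1
  refine Quot.sound (Glue.same _ _ ⟨hacts, fun e he => ?_⟩ _ _ fun a hc hd => ?_)
  · rw [c'.state_eq, d'.state_eq, Bool.eq_iff_iff, pathState_eq_true rfl, pathState_eq_true rfl]
    by_cases h1 : e.level ∈ c'.moved ∨ e.level + 1 ∈ c'.moved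
    · -- an occupied edge that ends at a moved vertex lies in the support of the action moving it
      have key (z : ℤ → ℤ) (hz : ∀ a ∈ c'.acts, ∃ b, Fits N z a b) :
          ¬ (0 ≤ e.level ∧ e.level < N ∧ z e.level = e.base.2 ∧
            z (e.level + 1) = e.base.2 + e.dir.rise) := by
        rintro ⟨-, -, h2, h3⟩
        rcases h1 with ⟨a, ha, hv⟩ | ⟨a, ha, hv⟩ <;> obtain ⟨b, hb⟩ := hz a ha
        · have h4 := hb.at_vertex
          have h5 := bitInt_eq b
          rw [hv] at h4
          exact he a ha (mem_sup_iff.2 (Or.inr ⟨hv.symm, by omega⟩))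
        · have h4 := hb.before
          rw [hv, add_sub_cancel_right] at h4
          exact he a ha (mem_sup_iff.2 (Or.inl ⟨by omega, by omega⟩))
      exact iff_of_false (key _ fun a ha => c'.exists_fits ha)
        (key _ fun a ha => d'.exists_fits (hacts ▸ ha))
    · rw [not_or] at h1
      rw [hheight _ h1.1, hheight _ h1.2]
  · have h1 := congrFun h a.vertex
    rw [c'.coord_vertex p' hc, d'.coord_vertex q' hd] at h1
    exact Subtype.ext (by linarith)

/-! ### Surjectivity -/

/-- Rounding down a real height function. -/
lemma HeightSpace.isHeight_floor {y : ℤ → ℝ} (hy : y ∈ HeightSpace N) :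
    IsHeight N fun k => ⌊y k⌋ := by
  refine ⟨fun k hk => by simp [hy.1 k hk], fun k h0 hN => ?_⟩
  obtain ⟨h1, h2, -⟩ := hy.2 k h0 hN
  have h3 := Int.floor_le_floor h1
  have h4 := Int.floor_le_floor h2
  rw [Int.floor_add_one] at h4
  simp only
  omega

/-- A vertex at non-integral height is in the course of a move of the rounded arm. -/
lemma HeightSpace.fits_floor {y : ℤ → ℝ} (hy : y ∈ HeightSpace N) {k : ℤ} (h1 : 1 ≤ k)
    (hN : k ≤ N) (hk : ∀ m : ℤ, y k ≠ m) :
    Fits N (fun k => ⌊y k⌋) (actionAt N (fun k => ⌊y k⌋) k) false := by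
  have h2 : ⌊y k⌋ = ⌊y (k - 1)⌋ := by
    have h := hy.2 (k - 1) (by omega) (by omega)
    rw [sub_add_cancel] at h
    obtain ⟨h3, h4, ⟨m, hm⟩ | ⟨m, hm⟩⟩ := h
    · rw [hm, Int.floor_intCast, Int.floor_eq_iff]
      have h5 := hk (m + 1)
      rw [hm] at h3 h4
      push_cast at h5
      exact ⟨h3, lt_of_le_of_ne h4 h5⟩
    · exact absurd hm (hk m)
  refine fits_actionAt h1 hN (by simpa [bitInt] using h2) fun h => ?_
  obtain ⟨h3, h4, ⟨m, hm⟩ | ⟨m, hm⟩⟩ := hy.2 k (by omega) h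
  · exact absurd hm (hk m)
  · rw [← h2, hm, Int.floor_intCast]
    have h5 := lt_of_le_of_ne h3 (hm ▸ hk m)
    have h6 : ⌊y k⌋ = m - 1 := by
      rw [Int.floor_eq_iff]
      push_cast
      constructor <;> linarith
    omega

lemma surjective_heightMap (N : ℕ) : Function.Surjective (heightMap N) := by
  rintro ⟨y, hy⟩
  set z : ℤ → ℤ := fun k => ⌊y k⌋ with hz
  have hzh : IsHeight N z := HeightSpace.isHeight_floor hy
  set K : Set ℤ := {k | (1 ≤ k ∧ k ≤ N) ∧ ∀ m : ℤ, y k ≠ m} with hK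
  have hfit (k : ℤ) (hk : k ∈ K) : Fits N z (actionAt N z k) false :=
    HeightSpace.fits_floor hy hk.1.1 hk.1.2 hk.2
  have hsucc (k : ℤ) (hk : k ∈ K) : k + 1 ∉ K := by
    intro hk'
    have h1 := hk.1.1
    have h2 := hk'.1.2
    rcases (hy.2 k (by omega) (by omega)).2.2 with ⟨m, hm⟩ | ⟨m, hm⟩
    · exact hk.2 m hm
    · exact hk'.2 m hm
  let c : Cube (positiveArm N) :=
    { state := pathState N z
      mem := mem_states_positiveArm.2 ⟨z, hzh, rfl⟩
      acts := actionAt N z '' K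
      finite := ((Set.finite_Icc (1 : ℤ) N).subset fun k hk => hk.1).image _
      commute := by
        rintro _ ⟨k, hk, rfl⟩ _ ⟨l, hl, rfl⟩ hne
        have hkl : k ≠ l := fun h => hne (h ▸ rfl)
        refine disjoint_of_vertex ?_ ?_ ?_ <;> rw [actionAt_vertex, actionAt_vertex]
        · exact hkl
        · exact fun h => hsucc k hk (h ▸ hl)
        · exact fun h => hsucc l hl (h ▸ hk)
      admissible := by
        rintro _ ⟨k, hk, rfl⟩
        exact ⟨false, (matches_pathState_iff hzh).2 (hfit k hk)⟩ }
  have hc : c.height = z := Cube.height_eq hzh rfl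
  let p : c.acts → I := fun a =>
    ⟨Int.fract (y a.1.vertex), Int.fract_nonneg _, (Int.fract_lt_one _).le⟩
  refine ⟨Quot.mk _ ⟨c, p⟩, Subtype.ext (funext fun k => ?_)⟩
  change c.coord p k = y k
  by_cases hk : k ∈ K
  · have ha : actionAt N z k ∈ c.acts := ⟨k, hk, rfl⟩
    have h1 := c.coord_vertex p ha
    have h2 := (hfit k hk).at_vertex
    simp only [bitInt, Bool.false_eq_true, if_false, add_zero] at h2
    rw [← h2] at h1
    simp only [p, actionAt_vertex, hz, Int.floor_add_fract] at h1
    exact h1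
  · rw [c.coord_of_notMem, hc]
    · by_cases hk' : k ≤ 0 ∨ (N : ℤ) < k
      · simp [hz, hy.1 k hk']
      · by_contra hne
        push Not at hk'
        refine hk ⟨⟨hk'.1, hk'.2⟩, fun m hm => hne ?_⟩
        simp [hz, hm]
    · rintro ⟨_, ⟨l, hl, rfl⟩, hlk⟩
      rw [actionAt_vertex] at hlk
      exact hk (hlk ▸ hl)

/-! ### Compactness and the homeomorphism -/

lemma finite_states_positiveArm (N : ℕ) : (positiveArm N).states.Finite := by
  have h : {y : ℤ → ℤ | IsHeight N y}.Finite := by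
    refine Set.Finite.of_injOn (f := fun (y : ℤ → ℤ) (k : Fin (N + 1)) => y k)
      (t := Set.univ.pi fun k => Set.Icc 0 (N : ℤ)) ?_ ?_
      (Set.Finite.pi fun _ => Set.finite_Icc _ _)
    · intro y hy k _
      have := hy.mem_Icc k (by omega)
      exact ⟨this.1, by simp only; omega⟩
    · intro y hy z hz hyz
      funext k
      by_cases hk : k ≤ 0 ∨ (N : ℤ) < k
      · rw [hy.1 k hk, hz.1 k hk]
      · push Not at hk
        lift k to ℕ using hk.1.le
        exact congrFun hyz ⟨k, by omega⟩
  refine (h.image (pathState N)).subset fun U hU => ?_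
  obtain ⟨y, hy, rfl⟩ := mem_states_positiveArm.1 hU
  exact ⟨y, hy, rfl⟩

instance (N : ℕ) : Finite (Cube (positiveArm N)) := by
  have hadm : (⋃ U ∈ (positiveArm N).states,
      {a : Action (ℤ × ℤ) ArmMove | a.Admissible armCatalogue U}).Finite := by
    refine (finite_states_positiveArm N).biUnion fun U hU => ?_
    obtain ⟨y, hy, rfl⟩ := mem_states_positiveArm.1 hU
    refine ((Set.finite_Icc (1 : ℤ) N).image (actionAt N y)).subset ?_
    rintro a ⟨b, hb⟩
    have h := (matches_pathState_iff hy).1 hb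
    exact ⟨a.vertex, ⟨h.pos, h.le⟩, h.eq_actionAt.symm⟩
  have hfin := (finite_states_positiveArm N).prod hadm.powerset
  refine Set.finite_univ_iff.1 (Set.Finite.of_injOn
    (f := fun c : Cube (positiveArm N) => (c.state, c.acts)) ?_ ?_ hfin)
  · intro c _
    exact ⟨c.mem, fun a ha => Set.mem_biUnion c.mem (c.admissible a ha)⟩
  · intro c _ d _ h
    exact Cube.ext (congrArg Prod.fst h) (congrArg Prod.snd h)

instance (N : ℕ) : CompactSpace (StateComplex (positiveArm N)) :=
  inferInstanceAs (CompactSpace (Quot (Glue (positiveArm N))))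

/-- The state complex of the arm is homeomorphic to the space of height functions. -/
noncomputable def heightHomeomorph (N : ℕ) :
    StateComplex (positiveArm N) ≃ₜ HeightSpace N :=
  (continuous_heightMap N).homeoOfEquivCompactToT2
    (f := Equiv.ofBijective _ ⟨injective_heightMap N, surjective_heightMap N⟩)

end Metamorphic

theorem mainTheorem5 (N : ℕ) :
    ContractibleSpace (Metamorphic.StateComplex (Metamorphic.positiveArm N)) := by
  have := Metamorphic.contractibleSpace_heightSpace N
  exact (Metamorphic.heightHomeomorph N).contractibleSpace
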